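/- Conventions. Let $R$ be an integral domain with quotient field $K$. For a nonzero fractional ideal $I$ of $R$ put $I^{-1}=\{x\in K: xI\subseteq R\}$, $I^v=(I^{-1})^{-1}$, and let $I^t$ be the union of the sets $J^v$ over all nonzero finitely generated fractional subideals $J$ of $I$. A $t$-ideal of $R$ is a nonzero ideal $I$ of $R$ with $I^t=I$; a maximal $t$-ideal is an ideal maximal in the set of proper $t$-ideals of $R$. A $t$-rigid ideal is a nonzero finitely generated ideal contained in exactly one maximal $t$-ideal. A maximal $t$-ideal is called $t$-potent if it contains a $t$-rigid ideal, and the domain $R$ is called $t$-potent if each of its maximal $t$-ideals is $t$-potent. Theorem 4.2. Let $T$ be an integral domain, $M$ a maximal ideal of $T$, $\varphi:T\to k:=T/M$ the natural projection, $D$ a proper subring of $k$, and $R:=\varphi^{-1}(D)$. Then $R$ is $t$-potent if and only if each of the following conditions holds: (1) $D$ is $t$-potent or a field. (2) Every maximal $t$-ideal $N$ of $T$ with $N\not\subseteq M$ is $t$-potent. (3) If $D$ is a field and $M$ is a $t$-ideal of $T$, then $M$ is $t$-potent in $T$. -/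

import Mathlib

open scoped nonZeroDivisors

namespace TOp

noncomputable section

/-- The `v`-closure `I^v = (I⁻¹)⁻¹` of a nonzero fractional ideal `I` of a domain `R`, where
`I⁻¹ = {x ∈ K | x I ⊆ R}` and `K` is the quotient field of `R`. -/
def vClosure {R : Type*} [CommRing R] [IsDomain R]
    (I : FractionalIdeal R⁰ (FractionRing R)) : FractionalIdeal R⁰ (FractionRing R) :=
  1 / (1 / I)

/-- The `t`-closure of a nonzero fractional ideal `I`, as a subset of the quotient field:
the union of the `J^v`, with `J` ranging over the nonzero finitely generated fractional
subideals of `I`. -/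
def tClosure {R : Type*} [CommRing R] [IsDomain R]
    (I : FractionalIdeal R⁰ (FractionRing R)) : Set (FractionRing R) :=
  {x | ∃ J : FractionalIdeal R⁰ (FractionRing R),
    J ≠ 0 ∧ (J : Submodule R (FractionRing R)).FG ∧ J ≤ I ∧ x ∈ vClosure J}

/-- A `t`-ideal of `R`: a nonzero (integral) ideal `I` with `I^t = I`. -/
def IsTIdeal {R : Type*} [CommRing R] [IsDomain R] (I : Ideal R) : Prop :=
  I ≠ ⊥ ∧ tClosure (I : FractionalIdeal R⁰ (FractionRing R)) =
    {x | x ∈ (I : FractionalIdeal R⁰ (FractionRing R))}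

/-- A maximal `t`-ideal: an ideal maximal in the set of proper `t`-ideals. -/
def IsMaximalTIdeal {R : Type*} [CommRing R] [IsDomain R] (P : Ideal R) : Prop :=
  Maximal (fun I : Ideal R => IsTIdeal I ∧ I ≠ ⊤) P

/-- A `t`-rigid ideal: a nonzero finitely generated ideal contained in exactly one maximal
`t`-ideal. -/
def IsTRigid {R : Type*} [CommRing R] [IsDomain R] (I : Ideal R) : Prop :=
  I ≠ ⊥ ∧ I.FG ∧ ∃! P : Ideal R, IsMaximalTIdeal P ∧ I ≤ P

/-- A `t`-potent ideal: a maximal `t`-ideal that contains a `t`-rigid ideal. -/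
def IsTPotentIdeal {R : Type*} [CommRing R] [IsDomain R] (P : Ideal R) : Prop :=
  IsMaximalTIdeal P ∧ ∃ I : Ideal R, IsTRigid I ∧ I ≤ P

/-- A `t`-potent domain: every maximal `t`-ideal is `t`-potent. -/
def IsTPotentDomain (R : Type*) [CommRing R] [IsDomain R] : Prop :=
  ∀ P : Ideal R, IsMaximalTIdeal P → IsTPotentIdeal P

/-- The pullback `R = φ⁻¹(D)`, where `φ : T → T/M` is the natural projection and `D` is a
subring of `T/M`. -/
abbrev pullback {T : Type*} [CommRing T] (M : Ideal T) (D : Subring (T ⧸ M)) : Subring T :=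
  D.comap (Ideal.Quotient.mk M)

end

end TOp

/-! A proper `t`-ideal $P$ is a maximal `t`-ideal iff every $b\notin P$ has a finite $S\subseteq P$
with $1\in(S,b)^v$, and it is `t`-potent iff a single $S$ serves all $b$ (`isMaximalTIdeal_iff`,
`isTPotentIdeal_iff`). Both properties therefore move between rings together, once finite sets are
transported independently of $b$.

The maximal `t`-ideals $P$ of $R$ fall into three classes, since $M$ is itself a `t`-ideal of $R$
when it is nonzero. If $M\not\subseteq P$, then $P=Q\cap R$ for a prime $Q\not\subseteq M$ of $T$;
comaximality of $Q$ and $M$ makes $P$ and $Q$ maximal `t`-ideals, or `t`-potent, together. If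
$M\subsetneq P$, then $P$ is the preimage of a nonzero ideal of $D$ with the same properties
(`comap_residue_iff`). If $P=M$, then $D$ is a field, and $M$ is `t`-potent in $R$ iff it is so in
$T$ or is not a `t`-ideal of $T$. The three classes match conditions (2), (1) and (3). -/

open scoped nonZeroDivisors

namespace TOp

/-! ### Formal properties of `v`-closures tested in an overring -/

section VMem

variable {R : Type*} [CommRing R]

/-- `y` belongs to the `v`-closure of the ideal generated by `S`, tested in an overring `L`. -/
def VMem (L : Type*) [CommRing L] [Algebra R L] (S : Set R) (y : R) : Prop :=
  ∀ x : L, (∀ a ∈ S, x * algebraMap R L a ∈ (algebraMap R L).range) →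
    x * algebraMap R L y ∈ (algebraMap R L).range

variable {L : Type*} [CommRing L] [Algebra R L]

theorem VMem.of_mem {S : Set R} {y : R} (h : y ∈ S) : VMem L S y := fun _ hx => hx y h

theorem VMem.zero (S : Set R) : VMem L S 0 := fun x _ => by simp [zero_mem]

theorem VMem.add {S : Set R} {y z : R} (hy : VMem L S y) (hz : VMem L S z) :
    VMem L S (y + z) := fun x hx => by
  rw [map_add, mul_add]
  exact add_mem (hy x hx) (hz x hx)

theorem VMem.mul_left {S : Set R} {y : R} (r : R) (hy : VMem L S y) : VMem L S (r * y) :=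
  fun x hx => by
    rw [map_mul, mul_left_comm]
    exact mul_mem ⟨r, rfl⟩ (hy x hx)

theorem VMem.trans {S S' : Set R} {y : R} (h : VMem L S y) (hS : ∀ s ∈ S, VMem L S' s) :
    VMem L S' y := fun x hx => h x fun a ha => hS a ha x hx

theorem VMem.mono {S S' : Set R} {y : R} (h : VMem L S y) (hS : S ⊆ S') : VMem L S' y :=
  h.trans fun _ hs => .of_mem (hS hs)

theorem VMem.of_mem_span {S : Set R} {y : R} (h : y ∈ Ideal.span S) : VMem L S y := by
  induction h using Submodule.span_induction with
  | mem x h => exact .of_mem h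
  | zero => exact .zero S
  | add x y _ _ hx hy => exact hx.add hy
  | smul a x _ hx => exact hx.mul_left a

variable (L)

/-- The `t`-closure of a nonzero integral ideal, as an ideal. -/
def tHull (I : Ideal R) : Ideal R where
  carrier := {y | ∃ S : Set R, S.Finite ∧ S ⊆ I ∧ VMem L S y}
  add_mem' := by
    rintro y z ⟨S, hS, hSI, hy⟩ ⟨S', hS', hSI', hz⟩
    exact ⟨S ∪ S', hS.union hS', Set.union_subset hSI hSI',
      (hy.mono Set.subset_union_left).add (hz.mono Set.subset_union_right)⟩
  zero_mem' := ⟨∅, Set.finite_empty, Set.empty_subset _, .zero _⟩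
  smul_mem' := by
    rintro r y ⟨S, hS, hSI, hy⟩
    exact ⟨S, hS, hSI, hy.mul_left r⟩

theorem le_tHull (I : Ideal R) : I ≤ tHull L I := fun y hy =>
  ⟨{y}, Set.finite_singleton y, by simpa using hy, .of_mem rfl⟩

end VMem

/-! ### Elementwise criteria for `t`-ideals, maximal `t`-ideals and `t`-potency -/

section Field

variable {R : Type*} [CommRing R]
variable (L : Type*) [Field L] [Algebra R L] [FaithfulSMul R L]

/-- The right side does not mention `L`, so any field containing $R$ may replace the quotient field.
This allows testing $R$ inside a field over $T$, and $D$ inside $T/M$, which may exceed the quotient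
field of $D$. -/
theorem vMem_iff_dvd {S : Set R} (hS : ∃ a ∈ S, a ≠ 0) (y : R) :
    VMem L S y ↔ ∀ r s : R, s ≠ 0 → (∀ a ∈ S, s ∣ r * a) → s ∣ r * y := by
  have inj := FaithfulSMul.algebraMap_injective R L
  have key : ∀ (r s b : R), s ≠ 0 →
      (algebraMap R L r / algebraMap R L s * algebraMap R L b ∈ (algebraMap R L).range ↔
        s ∣ r * b) := by
    intro r s b hs
    have hs' : algebraMap R L s ≠ 0 := by simpa using hs
    constructor
    · rintro ⟨c, hc⟩
      refine ⟨c, inj ?_⟩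
      rw [map_mul, map_mul, hc]
      field_simp
    · rintro ⟨c, hc⟩
      refine ⟨c, ?_⟩
      have := congrArg (algebraMap R L) hc
      rw [map_mul, map_mul] at this
      field_simp
      rw [this, mul_comm]
  constructor
  · intro h r s hs hr
    exact (key r s y hs).1 (h _ fun a ha => (key r s a hs).2 (hr a ha))
  · intro h x hx
    obtain ⟨a, ha, ha0⟩ := hS
    obtain ⟨r, hr⟩ := hx a ha
    have ha' : algebraMap R L a ≠ 0 := by simpa using ha0
    obtain rfl : x = algebraMap R L r / algebraMap R L a := by rw [hr]; field_simp
    exact (key r a y ha0).2 (h r a ha0 fun b hb => (key r a b ha0).1 (hx b hb))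

theorem vMem_congr (L' : Type*) [Field L'] [Algebra R L'] [FaithfulSMul R L'] {S : Set R}
    (hS : ∃ a ∈ S, a ≠ 0) (y : R) : VMem L S y ↔ VMem L' S y :=
  (vMem_iff_dvd L hS y).trans (vMem_iff_dvd L' hS y).symm

variable [IsDomain R]

theorem mem_vClosure_coeIdeal {J : Ideal R} (hJ : J ≠ ⊥) (x : FractionRing R) :
    x ∈ vClosure (J : FractionalIdeal R⁰ (FractionRing R)) ↔
      ∃ y : R, algebraMap R (FractionRing R) y = x ∧ VMem (FractionRing R) (J : Set R) y := by
  have hJ' : (J : FractionalIdeal R⁰ (FractionRing R)) ≠ 0 := by simpa using hJ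
  have h1 : ∀ z, z ∈ (1 / J : FractionalIdeal R⁰ (FractionRing R)) ↔
      ∀ a ∈ J, z * algebraMap R (FractionRing R) a ∈ (algebraMap R (FractionRing R)).range := by
    intro z
    rw [FractionalIdeal.mem_div_iff_of_ne_zero hJ']
    simp only [FractionalIdeal.mem_one_iff, FractionalIdeal.mem_coeIdeal, RingHom.mem_range]
    constructor
    · intro h a ha
      exact h _ ⟨a, ha, rfl⟩
    · rintro h _ ⟨a, ha, rfl⟩
      exact h a ha
  -- Since $J\subseteq R$, $1\in J^{-1}$: this makes $J^{-1}$ nonzero and forces $J^v\subseteq R$.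
  have hone : (1 : FractionRing R) ∈ (1 / J : FractionalIdeal R⁰ (FractionRing R)) :=
    (h1 1).2 fun a _ => ⟨a, by simp⟩
  have h0 : (1 / J : FractionalIdeal R⁰ (FractionRing R)) ≠ 0 := by
    intro h
    rw [h] at hone
    exact one_ne_zero ((FractionalIdeal.mem_zero_iff _).1 hone)
  rw [vClosure, FractionalIdeal.mem_div_iff_of_ne_zero h0]
  simp only [FractionalIdeal.mem_one_iff]
  constructor
  · intro h
    obtain ⟨y, hy⟩ := h 1 hone
    rw [mul_one] at hy
    refine ⟨y, hy, fun z hz => ?_⟩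
    rw [hy, mul_comm]
    exact h z ((h1 z).2 hz)
  · rintro ⟨y, rfl, hy⟩ z hz
    rw [mul_comm]
    exact hy z ((h1 z).1 hz)

theorem isTIdeal_iff {P : Ideal R} :
    IsTIdeal P ↔ P ≠ ⊥ ∧ ∀ S : Set R, S.Finite → S ⊆ P → (∃ a ∈ S, a ≠ 0) →
      ∀ y, VMem L S y → y ∈ P := by
  refine and_congr_right fun hP => ?_
  have inj := FaithfulSMul.algebraMap_injective R (FractionRing R)
  constructor
  · intro h S hfin hSP hS y hy
    have hspan : Ideal.span S ≠ ⊥ := by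
      obtain ⟨a, ha, ha0⟩ := hS
      exact fun hbot => ha0 ((Submodule.eq_bot_iff _).1 hbot a (Ideal.subset_span ha))
    have hmem : algebraMap R (FractionRing R) y ∈
        tClosure (P : FractionalIdeal R⁰ (FractionRing R)) := by
      refine ⟨(Ideal.span S : Ideal R), FractionalIdeal.coeIdeal_ne_zero.2 hspan, ?_, ?_, ?_⟩
      · rw [FractionalIdeal.coe_coeIdeal, IsLocalization.coeSubmodule_fg _ inj]
        exact Submodule.fg_span hfin
      · exact (FractionalIdeal.coeIdeal_le_coeIdeal _).2 (Ideal.span_le.2 hSP)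
      · refine (mem_vClosure_coeIdeal hspan _).2 ⟨y, rfl, ?_⟩
        exact ((vMem_congr L _ hS y).1 hy).mono Ideal.subset_span
    rw [h] at hmem
    obtain ⟨z, hz, hzy⟩ := (FractionalIdeal.mem_coeIdeal _).1 hmem
    exact inj hzy ▸ hz
  · intro h
    ext x
    constructor
    · rintro ⟨J, hJ0, hfg, hJP, hx⟩
      obtain ⟨J, rfl⟩ := FractionalIdeal.le_one_iff_exists_coeIdeal.1
        (hJP.trans FractionalIdeal.coeIdeal_le_one)
      have hJ : J ≠ ⊥ := by simpa using hJ0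
      obtain ⟨y, rfl, hy⟩ := (mem_vClosure_coeIdeal hJ x).1 hx
      rw [FractionalIdeal.coe_coeIdeal, IsLocalization.coeSubmodule_fg _ inj] at hfg
      obtain ⟨S, hSfin, rfl⟩ := Submodule.fg_def.1 hfg
      have hS : ∃ a ∈ S, a ≠ 0 := by
        by_contra! hcon
        exact hJ (Ideal.span_eq_bot.2 hcon)
      refine (FractionalIdeal.mem_coeIdeal _).2 ⟨y, h S hSfin ?_ hS y ?_, rfl⟩
      · exact Ideal.subset_span.trans ((FractionalIdeal.coeIdeal_le_coeIdeal _).1 hJP)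
      · exact (vMem_congr (FractionRing R) L hS y).1 (hy.trans fun s hs => .of_mem_span hs)
    · intro hx
      obtain ⟨y, hy, rfl⟩ := (FractionalIdeal.mem_coeIdeal _).1 hx
      -- `tClosure` admits only nonzero $J$, so $y=0$ needs another generator.
      by_cases hy0 : y = 0
      · obtain ⟨a, haP, ha0⟩ := Submodule.exists_mem_ne_zero_of_ne_bot hP
        refine ⟨(Ideal.span {a} : Ideal R), FractionalIdeal.coeIdeal_ne_zero.2 (by simpa using ha0), ?_, ?_, ?_⟩
        · rw [FractionalIdeal.coe_coeIdeal, IsLocalization.coeSubmodule_fg _ inj]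
          exact Submodule.fg_span (Set.finite_singleton a)
        · exact (FractionalIdeal.coeIdeal_le_coeIdeal _).2 (by simpa [Ideal.span_le] using haP)
        · rw [hy0, map_zero]
          exact zero_mem (vClosure _).coeToSubmodule
      · have hspan : Ideal.span {y} ≠ ⊥ := by simpa using hy0
        refine ⟨(Ideal.span {y} : Ideal R), FractionalIdeal.coeIdeal_ne_zero.2 hspan, ?_, ?_, ?_⟩
        · rw [FractionalIdeal.coe_coeIdeal, IsLocalization.coeSubmodule_fg _ inj]
          exact Submodule.fg_span (Set.finite_singleton y)
        · exact (FractionalIdeal.coeIdeal_le_coeIdeal _).2 (by simpa [Ideal.span_le] using hy)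
        · exact (mem_vClosure_coeIdeal hspan _).2
            ⟨y, rfl, .of_mem (Ideal.mem_span_singleton_self y)⟩

theorem isTIdeal_tHull {I : Ideal R} (hI : I ≠ ⊥) : IsTIdeal (tHull L I) := by
  refine (isTIdeal_iff L).2 ⟨fun h => hI (le_bot_iff.1 (h ▸ le_tHull L I)), ?_⟩
  intro S hS hSI _ y hy
  have hSI' : ∀ s ∈ S, ∃ A : Set R, A.Finite ∧ A ⊆ I ∧ VMem L A s := fun s hs => hSI hs
  choose! F hF hFI hFv using hSI'
  exact ⟨⋃ s ∈ S, F s, hS.biUnion hF, Set.iUnion₂_subset hFI,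
    hy.trans fun s hs => (hFv s hs).mono (Set.subset_biUnion_of_mem hs)⟩

/-- Zorn applies because `t`-closure is of finite type: a finite subset of the union of a chain lies
in one member. -/
theorem exists_le_isMaximalTIdeal {I : Ideal R} (hI : IsTIdeal I) (htop : I ≠ ⊤) :
    ∃ P, IsMaximalTIdeal P ∧ I ≤ P := by
  obtain ⟨P, hIP, hP⟩ := zorn_le_nonempty₀ {J : Ideal R | IsTIdeal J ∧ J ≠ ⊤} (by
    intro C hC hchain J hJ
    refine ⟨sSup C, ⟨(isTIdeal_iff (FractionRing R)).2 ⟨?_, ?_⟩, ?_⟩, fun z hz => le_sSup hz⟩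
    · exact fun h => (hC hJ).1.1 (le_bot_iff.1 (h ▸ le_sSup hJ))
    · intro S hS hSC hS0 y hy
      have : ∃ A ∈ C, S ⊆ (A : Set R) := by
        have hcpt := (Submodule.fg_iff_compact (Ideal.span S)).1 (Submodule.fg_span hS)
        obtain ⟨A, hA, hSA⟩ := (CompleteLattice.isCompactElement_iff_le_of_directed_sSup_le _ _).1
          hcpt C ⟨J, hJ⟩ hchain.directedOn (Ideal.span_le.2 hSC)
        exact ⟨A, hA, Ideal.span_le.1 hSA⟩
      obtain ⟨A, hA, hSA⟩ := this
      exact le_sSup hA (((isTIdeal_iff (FractionRing R)).1 (hC hA).1).2 S hS hSA hS0 y hy)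
    · intro h
      have h1 : (1 : R) ∈ sSup C := h ▸ Submodule.mem_top
      obtain ⟨A, hA, h1A⟩ := (Submodule.mem_sSup_of_directed ⟨J, hJ⟩ hchain.directedOn).1 h1
      exact (hC hA).2 ((Ideal.eq_top_iff_one _).2 h1A)) I ⟨hI, htop⟩
  exact ⟨P, hP, hIP⟩

theorem isMaximalTIdeal_iff {P : Ideal R} :
    IsMaximalTIdeal P ↔ (IsTIdeal P ∧ P ≠ ⊤) ∧
      ∀ b ∉ P, ∃ S : Set R, S.Finite ∧ S ⊆ P ∧ VMem L (insert b S) 1 := by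
  constructor
  · intro h
    refine ⟨h.prop, fun b hb => ?_⟩
    have hne : P ⊔ Ideal.span {b} ≠ ⊥ := fun hbot =>
      h.prop.1.1 (le_bot_iff.1 (hbot ▸ le_sup_left))
    have htop : tHull L (P ⊔ Ideal.span {b}) = ⊤ := by
      by_contra hcon
      exact hb (h.le_of_ge ⟨isTIdeal_tHull L hne, hcon⟩ (le_sup_left.trans (le_tHull L _))
        (le_tHull L _ (le_sup_right (a := P) (Ideal.mem_span_singleton_self b))))
    obtain ⟨S, hS, hSP, hv⟩ : (1 : R) ∈ tHull L (P ⊔ Ideal.span {b}) := htop ▸ Submodule.mem_top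
    have hdec : ∀ s ∈ S, ∃ p ∈ P, ∃ r, p + r * b = s := by
      intro s hs
      obtain ⟨p, hp, q, hq, rfl⟩ := Submodule.mem_sup.1 (hSP hs)
      obtain ⟨r, rfl⟩ := Ideal.mem_span_singleton'.1 hq
      exact ⟨p, hp, r, rfl⟩
    choose! p hp r hr using hdec
    -- The finite set lies in $P+(b)$; keeping only the $P$-components loses nothing once $b$ is
    -- adjoined.
    refine ⟨p '' S, hS.image p, by rintro _ ⟨s, hs, rfl⟩; exact hp s hs, hv.trans fun s hs => ?_⟩
    rw [← hr s hs]
    exact (VMem.of_mem (.inr ⟨s, hs, rfl⟩)).add ((VMem.of_mem (.inl rfl)).mul_left _)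
  · rintro ⟨hP, h⟩
    refine ⟨hP, fun Q hQ hPQ b hbQ => ?_⟩
    by_contra hb
    obtain ⟨S, hS, hSP, hv⟩ := h b hb
    refine hQ.2 ((Ideal.eq_top_iff_one _).2 (((isTIdeal_iff L).1 hQ.1).2 (insert b S)
      (hS.insert b) (Set.insert_subset hbQ (hSP.trans hPQ)) ⟨b, .inl rfl, ?_⟩ 1 hv))
    rintro rfl
    exact hb P.zero_mem

/-- If $S$ generates a `t`-rigid ideal in $P$ and $1\notin(S,b)^v$, some maximal `t`-ideal contains
$S$ and $b$; by rigidity it is $P$, so $b\in P$. -/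
theorem isTPotentIdeal_iff {P : Ideal R} :
    IsTPotentIdeal P ↔ (IsTIdeal P ∧ P ≠ ⊤) ∧
      ∃ S : Set R, S.Finite ∧ S ⊆ P ∧ ∀ b ∉ P, VMem L (insert b S) 1 := by
  constructor
  · rintro ⟨hP, I, ⟨hI0, hfg, hI⟩, hIP⟩
    refine ⟨hP.prop, ?_⟩
    obtain ⟨S, hS, rfl⟩ := Submodule.fg_def.1 hfg
    refine ⟨S, hS, Ideal.span_le.1 hIP, fun b hb => ?_⟩
    by_contra hcon
    have hle : Ideal.span S ≤ Ideal.span (insert b S) := Ideal.span_mono (Set.subset_insert b S)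
    have hne : tHull L (Ideal.span (insert b S)) ≠ ⊤ := by
      intro htop
      obtain ⟨S', -, hS', hv⟩ : (1 : R) ∈ tHull L (Ideal.span (insert b S)) :=
        htop ▸ Submodule.mem_top
      exact hcon (hv.trans fun s hs => .of_mem_span (hS' hs))
    obtain ⟨Q, hQ, hQle⟩ := exists_le_isMaximalTIdeal
      (isTIdeal_tHull L fun h => hI0 (le_bot_iff.1 (h ▸ hle))) hne
    have hQle' := (le_tHull L _).trans hQle
    obtain rfl : Q = P := hI.unique ⟨hQ, hle.trans hQle'⟩ ⟨hP, hIP⟩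
    exact hb (hQle' (Ideal.subset_span (.inl rfl)))
  · rintro ⟨hP, S, hS, hSP, h⟩
    have hmax : IsMaximalTIdeal P :=
      (isMaximalTIdeal_iff L).2 ⟨hP, fun b hb => ⟨S, hS, hSP, h b hb⟩⟩
    -- `S` may have no nonzero element, whereas a rigid ideal must be nonzero.
    obtain ⟨p, hpP, hp0⟩ := Submodule.exists_mem_ne_zero_of_ne_bot hP.1.1
    have hle : Ideal.span (insert p S) ≤ P := Ideal.span_le.2 (Set.insert_subset hpP hSP)
    refine ⟨hmax, Ideal.span (insert p S), ⟨?_, Submodule.fg_span (hS.insert p), P,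
      ⟨hmax, hle⟩, ?_⟩, hle⟩
    · exact fun hbot => hp0 (Ideal.span_eq_bot.1 hbot p (.inl rfl))
    · rintro Q ⟨hQ, hSQ⟩
      refine hQ.eq_of_le hP fun b hbQ => ?_
      by_contra hb
      refine hQ.prop.2 ((Ideal.eq_top_iff_one _).2 (((isTIdeal_iff L).1 hQ.prop.1).2 (insert b S)
        (hS.insert b) (Set.insert_subset hbQ ((Set.subset_insert p S).trans
          (Ideal.span_le.1 hSQ))) ⟨b, .inl rfl, ?_⟩ 1 (h b hb)))
      rintro rfl
      exact hb P.zero_mem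

/-- If $ab\in P$ and $b\notin P$, scaling $1\in(S,b)^v$ by $a$ gives $a\in(aS,ab)^v\subseteq P$. -/
theorem IsMaximalTIdeal.isPrime {P : Ideal R} (hP : IsMaximalTIdeal P) : P.IsPrime := by
  refine ⟨hP.prop.2, fun {a b} hab => or_iff_not_imp_right.2 fun hb => ?_⟩
  by_cases ha : a = 0
  · exact ha ▸ P.zero_mem
  obtain ⟨S, hS, hSP, hv⟩ := ((isMaximalTIdeal_iff (FractionRing R)).1 hP).2 b hb
  refine ((isTIdeal_iff (FractionRing R)).1 hP.prop.1).2 ((a * ·) '' insert b S)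
    ((hS.insert b).image _) ?_ ⟨a * b, ⟨b, .inl rfl, rfl⟩, mul_ne_zero ha ?_⟩ a ?_
  · rintro _ ⟨s, rfl | hs, rfl⟩
    exacts [hab, P.mul_mem_left a (hSP hs)]
  · rintro rfl
    exact hb P.zero_mem
  · intro x hx
    simpa using hv (x * algebraMap R _ a) fun s hs => by
      simpa [mul_assoc] using hx (a * s) ⟨s, hs, rfl⟩

theorem isTIdeal_span_singleton {d : R} (hd : d ≠ 0) : IsTIdeal (Ideal.span {d}) := by
  refine (isTIdeal_iff (FractionRing R)).2 ⟨by simpa using hd, fun S _ hSd hS y hy => ?_⟩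
  have := (vMem_iff_dvd _ hS y).1 hy 1 d hd fun a ha => by
    simpa using Ideal.mem_span_singleton.1 (hSd ha)
  exact Ideal.mem_span_singleton.2 (by simpa using this)

end Field

/-! ### Transport of covers between two domains -/

section Transfer

variable {R R' : Type*} [CommRing R] [CommRing R']

theorem vMem_insert_one {L : Type*} [CommRing L] [Algebra R L] {b : R} {S : Set R} :
    VMem L (insert b S) 1 ↔ ∀ x : L, x * algebraMap R L b ∈ (algebraMap R L).range →
      (∀ a ∈ S, x * algebraMap R L a ∈ (algebraMap R L).range) → x ∈ (algebraMap R L).range := by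
  simp only [VMem, Set.forall_mem_insert, map_one, mul_one, and_imp]

variable [IsDomain R] [IsDomain R']
variable (L L' : Type*) [Field L] [Algebra R L] [FaithfulSMul R L]
  [Field L'] [Algebra R' L'] [FaithfulSMul R' L']

/-- `F` is chosen before `b'`, so one finite set valid for all `b` stays valid for all `b'`. -/
theorem isMaximalTIdeal_and_isTPotentIdeal_of_vMem {P : Ideal R} {P' : Ideal R'}
    (hP : IsTIdeal P → P ≠ ⊤ → IsTIdeal P' ∧ P' ≠ ⊤) (F : Set R → Set R')
    (hF : ∀ S : Set R, S.Finite → S ⊆ P → (F S).Finite ∧ F S ⊆ P')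
    (h : ∀ b' ∉ P', ∃ b ∉ P, ∀ S ⊆ (P : Set R), VMem L (insert b S) 1 →
      VMem L' (insert b' (F S)) 1) :
    (IsMaximalTIdeal P → IsMaximalTIdeal P') ∧ (IsTPotentIdeal P → IsTPotentIdeal P') := by
  rw [isMaximalTIdeal_iff L, isMaximalTIdeal_iff L', isTPotentIdeal_iff L, isTPotentIdeal_iff L']
  constructor
  · rintro ⟨⟨ht, htop⟩, hmax⟩
    refine ⟨hP ht htop, fun b' hb' => ?_⟩
    obtain ⟨b, hb, hS⟩ := h b' hb'
    obtain ⟨S, hfin, hSP, hv⟩ := hmax b hb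
    exact ⟨F S, (hF S hfin hSP).1, (hF S hfin hSP).2, hS S hSP hv⟩
  · rintro ⟨⟨ht, htop⟩, S, hfin, hSP, hv⟩
    refine ⟨hP ht htop, F S, (hF S hfin hSP).1, (hF S hfin hSP).2, fun b' hb' => ?_⟩
    obtain ⟨b, hb, hS⟩ := h b' hb'
    exact hS S hSP (hv b hb)

end Transfer

/-! ### Primes of $T$ not containing $M$ and their contractions to $R$ -/

section Pullback

variable {T : Type*} [CommRing T] {M : Ideal T} {D : Subring (T ⧸ M)}

theorem mem_pullback_of_mem {m : T} (hm : m ∈ M) : m ∈ pullback M D := by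
  simp [pullback, Ideal.Quotient.eq_zero_iff_mem.2 hm, zero_mem]

/-- The contraction to the pullback of an ideal of the overring. -/
abbrev contraction (D : Subring (T ⧸ M)) (Q : Ideal T) : Ideal (pullback M D) :=
  Q.comap (pullback M D).subtype

section Overfield

variable (L : Type*) [CommRing L] [Algebra T L]

theorem algebraMap_pullback (r : pullback M D) :
    algebraMap (pullback M D) L r = algebraMap T L r := rfl

variable {L}

theorem mem_range_pullback {z : L} : z ∈ (algebraMap (pullback M D) L).range ↔
    ∃ t : T, Ideal.Quotient.mk M t ∈ D ∧ algebraMap T L t = z :=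
  ⟨fun ⟨r, hr⟩ => ⟨r, r.2, hr⟩, fun ⟨t, ht, h⟩ => ⟨⟨t, ht⟩, h⟩⟩

theorem range_pullback_le : (algebraMap (pullback M D) L).range ≤ (algebraMap T L).range := by
  rintro _ ⟨r, rfl⟩
  exact ⟨r, rfl⟩

theorem mul_mem_range_pullback {z : L} (hz : z ∈ (algebraMap T L).range) {m : T} (hm : m ∈ M) :
    z * algebraMap T L m ∈ (algebraMap (pullback M D) L).range := by
  obtain ⟨t, rfl⟩ := hz
  exact ⟨⟨t * m, mem_pullback_of_mem (M.mul_mem_left t hm)⟩, by simp [algebraMap_pullback]⟩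

/-- An element of `L` lies in `T` as soon as its products with two comaximal elements do. -/
theorem mem_range_of_mul_add_eq_one {x : L} {a t m : T} (h : a * t + m = 1)
    (ha : x * algebraMap T L a ∈ (algebraMap T L).range)
    (hm : x * algebraMap T L m ∈ (algebraMap T L).range) : x ∈ (algebraMap T L).range := by
  have : x = x * algebraMap T L a * algebraMap T L t + x * algebraMap T L m := by
    rw [mul_assoc, ← mul_add, ← map_mul, ← map_add, h, map_one, mul_one]
  rw [this]
  exact add_mem (mul_mem ha ⟨t, rfl⟩) hm

/-- A covering in `R` extends to one in `T`. -/
theorem vMem_image_of_vMem_pullback {S : Set (pullback M D)} {c a t m : T} {b : pullback M D}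
    (h : a * t + m = 1) (hm : m ∈ M) (ha : a = c ∨ ∃ s ∈ S, (s : T) = a)
    (hb : ∀ n ∈ M, ∃ n' ∈ M, n * (b : T) = n' * c)
    (hv : VMem L (insert b S) 1) : VMem L (insert c ((↑) '' S)) 1 := by
  rw [vMem_insert_one] at hv ⊢
  intro x hc hS
  -- Instead of `x`, the cover in $R$ is applied to `x * m`: the factor from $M$ turns products
  -- lying in $T$ into products lying in $R$.
  refine mem_range_of_mul_add_eq_one h ?_ (range_pullback_le (hv _ ?_ fun s hs => ?_))
  · obtain rfl | ⟨s, hs, rfl⟩ := ha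
    exacts [hc, hS _ ⟨s, hs, rfl⟩]
  · obtain ⟨n, hn, hnb⟩ := hb m hm
    rw [algebraMap_pullback, mul_assoc, ← map_mul, hnb, mul_comm n, map_mul, ← mul_assoc]
    exact mul_mem_range_pullback hc hn
  · rw [mul_right_comm]
    exact mul_mem_range_pullback (hS _ ⟨s, hs, rfl⟩) hm

end Overfield

theorem exists_mul_add_eq_one [M.IsMaximal] {a : T} (ha : a ∉ M) : ∃ t, ∃ m ∈ M, a * t + m = 1 := by
  obtain ⟨t, m, hm, h⟩ := Ideal.IsMaximal.exists_inv ‹_› ha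
  exact ⟨t, m, hm, by rw [mul_comm, h]⟩

theorem exists_ne_zero_of_image {S : Set (pullback M D)} (hS : ∃ a ∈ S, a ≠ 0) :
    ∃ a ∈ ((↑) '' S : Set T), a ≠ 0 := by
  obtain ⟨a, ha, ha0⟩ := hS
  exact ⟨a, ⟨a, ha, rfl⟩, by simpa using ha0⟩

/-- A prime of the pullback not containing `M` is the contraction of a prime of `T`. -/
theorem exists_contraction_eq {P : Ideal (pullback M D)} [P.IsPrime]
    (hP : ¬ contraction D M ≤ P) :
    ∃ Q : Ideal T, Q.IsPrime ∧ ¬ M ≤ Q ∧ contraction D Q = P := by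
  obtain ⟨m, hm, hmP⟩ := SetLike.not_le_iff_exists.1 hP
  let f : T → pullback M D := fun x => ⟨x * m, mem_pullback_of_mem (M.mul_mem_left x hm)⟩
  have hf : ∀ x y, f (x * y) * m = f x * f y := fun x y =>
    Subtype.ext (show x * y * m * m = x * m * (y * m) by ring)
  have hfr : ∀ r : pullback M D, f r = r * m := fun r => rfl
  -- $Q=(P:_T m)$ for a fixed $m\in M\setminus P$; `hf` is what makes it a prime ideal of $T$.
  let Q : Ideal T :=
    { carrier := {x | f x ∈ P}
      add_mem' := fun {x y} hx hy => by
        have : f (x + y) = f x + f y := Subtype.ext (add_mul x y m)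
        exact (this ▸ P.add_mem hx hy : f (x + y) ∈ P)
      zero_mem' := by
        have : f 0 = 0 := Subtype.ext (zero_mul _)
        exact (this ▸ P.zero_mem : f 0 ∈ P)
      smul_mem' := fun c x hx => by
        have : f (c * x) * m ∈ P := hf c x ▸ P.mul_mem_left _ hx
        exact (Ideal.IsPrime.mem_or_mem ‹_› this).resolve_right hmP }
  have hmem : ∀ r : pullback M D, (r : T) ∈ Q ↔ r ∈ P := fun r =>
    ⟨fun h => (Ideal.IsPrime.mem_or_mem ‹_› (hfr r ▸ h : r * m ∈ P)).resolve_right hmP,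
      fun h => (hfr r ▸ P.mul_mem_right m h : f r ∈ P)⟩
  refine ⟨Q, ⟨?_, fun {x y} hxy => ?_⟩, fun h => hmP ((hmem m).1 (h hm)), Ideal.ext hmem⟩
  · intro h
    have h1 : ((1 : pullback M D) : T) ∈ Q := h ▸ Submodule.mem_top
    exact Ideal.IsPrime.ne_top ‹_› ((Ideal.eq_top_iff_one _).2 ((hmem 1).1 h1))
  · have : f x * f y ∈ P := hf x y ▸ P.mul_mem_right m hxy
    exact Ideal.IsPrime.mem_or_mem (I := P) ‹_› this

variable [IsDomain T]

instance (L : Type*) [Field L] [Algebra T L] [FaithfulSMul T L] :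
    FaithfulSMul (pullback M D) L :=
  (faithfulSMul_iff_algebraMap_injective _ _).2
    ((FaithfulSMul.algebraMap_injective T L).comp Subtype.val_injective)

section Prime

variable {Q : Ideal T} [Q.IsPrime]

theorem isTIdeal_contraction_iff (L : Type*) [Field L] [Algebra T L] [FaithfulSMul T L]
    (hMQ : ¬ M ≤ Q) : IsTIdeal (contraction D Q) ↔ IsTIdeal Q := by
  obtain ⟨m, hm, hmQ⟩ := SetLike.not_le_iff_exists.1 hMQ
  have hm0 : m ≠ 0 := fun h => hmQ (h ▸ Q.zero_mem)
  rw [isTIdeal_iff L, isTIdeal_iff L]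
  constructor
  · rintro ⟨h0, h⟩
    refine ⟨?_, fun S hS hSQ hS0 y hy => ?_⟩
    · rintro rfl
      exact h0 ((Submodule.eq_bot_iff _).2 fun x hx => Subtype.ext hx)
    -- One factor `m` brings `S` into $R$; the other brings the resulting product from $T$ back into
    -- $R$.
    · have hv : (⟨y * (m * m), mem_pullback_of_mem (M.mul_mem_left _ (M.mul_mem_left _ hm))⟩ :
          pullback M D) ∈ contraction D Q := by
        refine h ((fun s : T => ⟨s * m, mem_pullback_of_mem (M.mul_mem_left s hm)⟩) '' S)
          (hS.image _) ?_ ?_ _ fun x hx => ?_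
        · rintro _ ⟨s, hs, rfl⟩
          exact Q.mul_mem_right _ (hSQ hs)
        · obtain ⟨s, hs, hs0⟩ := hS0
          exact ⟨_, ⟨s, hs, rfl⟩, fun h => mul_ne_zero hs0 hm0 (congrArg Subtype.val h)⟩
        · have := hy (x * algebraMap T _ m) fun s hs => by
            have : x * algebraMap T L (s * m) ∈ _ := range_pullback_le (hx _ ⟨s, hs, rfl⟩)
            rwa [map_mul, mul_comm (algebraMap T _ s), ← mul_assoc] at this
          convert mul_mem_range_pullback this hm using 1
          rw [algebraMap_pullback, map_mul, map_mul]
          ring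
      have hv' : y * (m * m) ∈ Q := hv
      exact (Ideal.IsPrime.mem_or_mem ‹_› hv').resolve_right
        fun h => hmQ ((Ideal.IsPrime.mem_or_mem ‹_› h).elim id id)
  · rintro ⟨h0, h⟩
    refine ⟨?_, fun S hS hSQ hS0 y hy => ?_⟩
    · obtain ⟨q, hq, hq0⟩ := Submodule.exists_mem_ne_zero_of_ne_bot h0
      intro hbot
      have : (⟨q * m, mem_pullback_of_mem (M.mul_mem_left q hm)⟩ : pullback M D) ∈
        contraction D Q := Q.mul_mem_right m hq
      rw [hbot] at this
      exact mul_ne_zero hq0 hm0 (congrArg Subtype.val this)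
    · have hv : (y : T) * m ∈ Q := by
        refine h ((↑) '' S) (hS.image _) ?_ (exists_ne_zero_of_image hS0) _ fun x hx => ?_
        · rintro _ ⟨s, hs, rfl⟩
          exact hSQ hs
        · have := range_pullback_le (hy (x * algebraMap T _ m) fun s hs => by
            rw [mul_right_comm]
            exact mul_mem_range_pullback (hx _ ⟨s, hs, rfl⟩) hm)
          rwa [mul_assoc, algebraMap_pullback, ← map_mul, mul_comm m] at this
      exact (Ideal.IsPrime.mem_or_mem ‹_› hv).resolve_right hmQ

variable [M.IsMaximal]

theorem isMaximalTIdeal_and_isTPotentIdeal_of_contraction (L : Type*) [Field L]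
    [Algebra T L] [FaithfulSMul T L] (hMQ : ¬ M ≤ Q) (hQM : ¬ Q ≤ M) :
    (IsMaximalTIdeal (contraction D Q) → IsMaximalTIdeal Q) ∧
      (IsTPotentIdeal (contraction D Q) → IsTPotentIdeal Q) := by
  obtain ⟨m, hm, hmQ⟩ := SetLike.not_le_iff_exists.1 hMQ
  obtain ⟨q, hq, hqM⟩ := SetLike.not_le_iff_exists.1 hQM
  obtain ⟨t, n, hn, h⟩ := exists_mul_add_eq_one hqM
  have hqt : q * t ∈ pullback M D := by
    rw [eq_sub_of_add_eq h]
    exact sub_mem (one_mem _) (mem_pullback_of_mem hn)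
  refine isMaximalTIdeal_and_isTPotentIdeal_of_vMem L L
    (fun ht _ => ⟨(isTIdeal_contraction_iff L hMQ).1 ht, Ideal.IsPrime.ne_top ‹_›⟩)
    -- `q * t` lies in $Q\cap R$ and is comaximal with `n` in $M$, as the passage from $R$ to $T$
    -- requires.
    (fun S => (↑) '' insert ⟨q * t, hqt⟩ S) (fun S hS hSP => ⟨(hS.insert _).image _, ?_⟩)
    fun c hc => ⟨⟨c * m, mem_pullback_of_mem (M.mul_mem_left c hm)⟩, ?_, fun S hS hv => ?_⟩
  · rintro _ ⟨s, rfl | hs, rfl⟩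
    exacts [Q.mul_mem_right t hq, hSP hs]
  · exact fun hcm => (Ideal.IsPrime.mem_or_mem ‹_› (show c * m ∈ Q from hcm)).elim hc hmQ
  · refine vMem_image_of_vMem_pullback (a := q * t) (t := 1) (by rwa [mul_one]) hn
      (.inr ⟨_, .inl rfl, rfl⟩) (fun k hk => ⟨k * m, M.mul_mem_left k hm, by ring⟩)
      (hv.mono (Set.insert_subset_insert (Set.subset_insert _ _)))

theorem isMaximalTIdeal_and_isTPotentIdeal_contraction (L : Type*) [Field L]
    [Algebra T L] [FaithfulSMul T L] (hMQ : ¬ M ≤ Q) (hQM : ¬ Q ≤ M) :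
    (IsMaximalTIdeal Q → IsMaximalTIdeal (contraction D Q)) ∧
      (IsTPotentIdeal Q → IsTPotentIdeal (contraction D Q)) := by
  obtain ⟨q, hq, hqM⟩ := SetLike.not_le_iff_exists.1 hQM
  obtain ⟨t, n, hn, h⟩ := exists_mul_add_eq_one hqM
  have hqt : q * t ∈ pullback M D := by
    rw [eq_sub_of_add_eq h]
    exact sub_mem (one_mem _) (mem_pullback_of_mem hn)
  have hqtD : Ideal.Quotient.mk M (q * t) = 1 := by
    rw [eq_sub_of_add_eq h, map_sub, Ideal.Quotient.eq_zero_iff_mem.2 hn, map_one, sub_zero]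
  refine isMaximalTIdeal_and_isTPotentIdeal_of_vMem L L
    (fun ht _ => ⟨(isTIdeal_contraction_iff L hMQ).2 ht,
      Ideal.IsPrime.ne_top (Ideal.comap_isPrime _ _)⟩)
    (fun S => insert ⟨q * t, hqt⟩
      ((fun s : T => ⟨s * n, mem_pullback_of_mem (M.mul_mem_left s hn)⟩) '' S))
    (fun S hS hSP => ⟨(hS.image _).insert _, ?_⟩)
    fun b hb => ⟨b, hb, fun S hS hv => ?_⟩
  · rintro _ (rfl | ⟨s, hs, rfl⟩)
    exacts [Q.mul_mem_right t hq, Q.mul_mem_right n (hSP hs)]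
  · rw [vMem_insert_one] at hv ⊢
    intro x hxb hx
    have hxq := hx _ (.inl rfl)
    have hxT : x ∈ (algebraMap T L).range := by
      refine mem_range_of_mul_add_eq_one (a := q * t) (t := 1) (by rwa [mul_one])
        (range_pullback_le hxq) (hv _ ?_ fun s hs => ?_)
      · rw [mul_right_comm]
        exact mul_mem (range_pullback_le hxb) ⟨n, rfl⟩
      · have : x * algebraMap T L (s * n) ∈ _ := range_pullback_le (hx _ (.inr ⟨s, hs, rfl⟩))
        rwa [map_mul, mul_comm (algebraMap T _ s), ← mul_assoc] at this
    -- Now $x\in T$, and $qt\equiv1$ modulo $M$, so $x$ and $xqt\in R$ have the same residue, which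
    -- lies in $D$.
    obtain ⟨y, rfl⟩ := hxT
    obtain ⟨z, hz, hzy⟩ := mem_range_pullback.1 hxq
    rw [algebraMap_pullback, ← map_mul] at hzy
    rw [FaithfulSMul.algebraMap_injective T L hzy, map_mul, hqtD, mul_one] at hz
    exact mem_range_pullback.2 ⟨y, hz, rfl⟩

end Prime

end Pullback

/-! ### Ideals of $R$ containing $M$, and ideals of $D$ -/

section Residue

variable {T : Type*} [CommRing T] {M : Ideal T} {D : Subring (T ⧸ M)}

/-- The restriction of the projection `T → T / M` to the pullback of `D`. -/
def residue (M : Ideal T) (D : Subring (T ⧸ M)) : pullback M D →+* D :=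
  (Ideal.Quotient.mk M).restrict (pullback M D) D fun _ h => h

theorem coe_residue (r : pullback M D) : (residue M D r : T ⧸ M) = Ideal.Quotient.mk M r := rfl

theorem residue_surjective : Function.Surjective (residue M D) := by
  rintro ⟨d, hd⟩
  obtain ⟨t, rfl⟩ := Ideal.Quotient.mk_surjective d
  exact ⟨⟨t, hd⟩, rfl⟩

theorem residue_eq_zero_iff {r : pullback M D} : residue M D r = 0 ↔ r ∈ contraction D M := by
  rw [← Subring.coe_eq_zero_iff, coe_residue, Ideal.Quotient.eq_zero_iff_mem]
  rfl

theorem range_algebraMap_subring {K : Type*} [CommRing K] (D : Subring K) (x : K) :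
    x ∈ (algebraMap D K).range ↔ x ∈ D :=
  ⟨fun ⟨d, hd⟩ => hd ▸ d.2, fun h => ⟨⟨x, h⟩, rfl⟩⟩

section Overfield

variable {L : Type*} [CommRing L] [Algebra T L]

theorem algebraMap_mul_mem_range_pullback [FaithfulSMul T L] {t : T} {r : pullback M D} :
    algebraMap T L t * algebraMap (pullback M D) L r ∈ (algebraMap (pullback M D) L).range ↔
      Ideal.Quotient.mk M t * (residue M D r : T ⧸ M) ∈ D := by
  rw [mem_range_pullback, algebraMap_pullback, ← map_mul, coe_residue, ← map_mul]
  constructor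
  · rintro ⟨z, hz, h⟩
    rwa [FaithfulSMul.algebraMap_injective T L h] at hz
  · exact fun h => ⟨_, h, rfl⟩

end Overfield

theorem exists_comap_residue_eq {P : Ideal (pullback M D)} (hP : contraction D M < P) :
    ∃ J : Ideal D, J ≠ ⊥ ∧ J.comap (residue M D) = P := by
  refine ⟨P.map (residue M D), fun hbot => ?_, ?_⟩
  · exact hP.not_ge fun x hx => residue_eq_zero_iff.1
      ((Submodule.eq_bot_iff _).1 hbot _ (Ideal.mem_map_of_mem _ hx))
  · rw [Ideal.comap_map_of_surjective _ residue_surjective, sup_eq_left]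
    exact fun x hx => hP.le (residue_eq_zero_iff.1 hx)

theorem isMaximal_contraction_self [M.IsMaximal] (hD : IsField D) : (contraction D M).IsMaximal := by
  let := hD.toField
  have : contraction D M = (⊥ : Ideal D).comap (residue M D) :=
    Ideal.ext fun r => residue_eq_zero_iff.symm
  rw [this]
  exact Ideal.comap_isMaximal_of_surjective _ residue_surjective (K := ⊥)

variable [IsDomain T] [M.IsMaximal]

/-- A nonzero ideal of `D` is a `t`-ideal, a maximal `t`-ideal or a `t`-potent ideal exactly when
its preimage in the pullback is. -/
theorem comap_residue_iff (L : Type*) [Field L] [Algebra T L] [FaithfulSMul T L]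
    {J : Ideal D} (hJ : J ≠ ⊥) :
    (IsTIdeal (J.comap (residue M D)) ↔ IsTIdeal J) ∧
      (IsMaximalTIdeal (J.comap (residue M D)) ↔ IsMaximalTIdeal J) ∧
      (IsTPotentIdeal (J.comap (residue M D)) ↔ IsTPotentIdeal J) := by
  let : Field (T ⧸ M) := Ideal.Quotient.field M
  obtain ⟨d, hd, hd0⟩ := Submodule.exists_mem_ne_zero_of_ne_bot hJ
  obtain ⟨a, rfl⟩ := residue_surjective d
  have haM : (a : T) ∉ M := fun h => hd0 (residue_eq_zero_iff.2 h)
  obtain ⟨t, m, hm, h⟩ := exists_mul_add_eq_one haM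
  have ha0 : a ≠ 0 := fun h => hd0 (h ▸ map_zero _)
  obtain ⟨σ, hσ⟩ := residue_surjective (M := M) (D := D).hasRightInverse
  have hmP : (⟨m, mem_pullback_of_mem hm⟩ : pullback M D) ∈ J.comap (residue M D) := by
    rw [Ideal.mem_comap, residue_eq_zero_iff.2 (show _ ∈ M from hm)]
    exact J.zero_mem
  -- Adjoining `a` and `m`, comaximal in $T$, forces every `x` with $xF(S)\subseteq R$ into $T$, so
  -- that it has a residue in $T/M$ to test against $D$.
  let F : Set D → Set (pullback M D) := fun S =>
    insert a (insert ⟨m, mem_pullback_of_mem hm⟩ (σ '' S))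
  have hF : ∀ S : Set D, S.Finite → S ⊆ J → (F S).Finite ∧ F S ⊆ J.comap (residue M D) := by
    refine fun S hS hSJ => ⟨((hS.image _).insert _).insert _, ?_⟩
    rintro _ (rfl | rfl | ⟨s, hs, rfl⟩)
    · exact hd
    · exact hmP
    · rw [SetLike.mem_coe, Ideal.mem_comap, hσ s]
      exact hSJ hs
  have hFL : ∀ S : Set D, ∀ x : L, (∀ s ∈ F S, x * algebraMap (pullback M D) L s ∈
      (algebraMap (pullback M D) L).range) →
      ∃ y, algebraMap T L y = x ∧ ∀ s ∈ S, Ideal.Quotient.mk M y * (s : T ⧸ M) ∈ D := by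
    intro S x hx
    obtain ⟨y, rfl⟩ := mem_range_of_mul_add_eq_one h (range_pullback_le (hx a (.inl rfl)))
      (range_pullback_le (hx _ (.inr (.inl rfl))))
    refine ⟨y, rfl, fun s hs => ?_⟩
    simpa [hσ s] using algebraMap_mul_mem_range_pullback.1 (hx (σ s) (.inr (.inr ⟨s, hs, rfl⟩)))
  have ht : IsTIdeal (J.comap (residue M D)) ↔ IsTIdeal J := by
    rw [isTIdeal_iff L, isTIdeal_iff (T ⧸ M)]
    constructor
    · rintro ⟨-, hP⟩
      refine ⟨hJ, fun S hS hSJ _ y hy => ?_⟩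
      rw [← hσ y, ← Ideal.mem_comap]
      refine hP (F S) (hF S hS hSJ).1 (hF S hS hSJ).2 ⟨a, .inl rfl, ha0⟩ _ fun x hx => ?_
      obtain ⟨z, rfl, hz⟩ := hFL S x hx
      rw [algebraMap_mul_mem_range_pullback, hσ y]
      exact (range_algebraMap_subring D _).1
        (hy _ fun s hs => (range_algebraMap_subring D _).2 (hz s hs))
    · rintro ⟨-, hJt⟩
      refine ⟨fun hbot => ha0 ((Submodule.eq_bot_iff _).1 hbot a hd), fun S hS hSP _ y hy => ?_⟩
      refine hJt (insert (residue M D a) (residue M D '' S)) ((hS.image _).insert _)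
        ?_ ⟨_, .inl rfl, hd0⟩ _ fun x hx => ?_
      · rintro _ (rfl | ⟨s, hs, rfl⟩)
        exacts [hd, hSP hs]
      · obtain ⟨x, rfl⟩ := Ideal.Quotient.mk_surjective x
        rw [range_algebraMap_subring]
        exact algebraMap_mul_mem_range_pullback.1 (hy (algebraMap T L x) fun s hs =>
          algebraMap_mul_mem_range_pullback.2
            ((range_algebraMap_subring D _).1 (hx _ (.inr ⟨s, hs, rfl⟩))))
  have htop : J.comap (residue M D) ≠ ⊤ ↔ J ≠ ⊤ := not_congr Ideal.comap_eq_top_iff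
  have h1 := isMaximalTIdeal_and_isTPotentIdeal_of_vMem L (T ⧸ M)
    (P := J.comap (residue M D)) (P' := J) (fun h h' => ⟨ht.1 h, htop.1 h'⟩)
    (fun S => residue M D '' S)
    (fun S hS hSP => ⟨hS.image _, by rintro _ ⟨s, hs, rfl⟩; exact hSP hs⟩)
    (fun b hb => ⟨σ b, by rwa [Ideal.mem_comap, hσ b], fun S _ hv => by
      rw [vMem_insert_one] at hv ⊢
      intro x hxb hx
      obtain ⟨x, rfl⟩ := Ideal.Quotient.mk_surjective x
      obtain ⟨z, hz, hzx⟩ := mem_range_pullback.1 (hv (algebraMap T L x)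
        (algebraMap_mul_mem_range_pullback.2
          (by rw [hσ b]; exact (range_algebraMap_subring D _).1 hxb))
        fun s hs => algebraMap_mul_mem_range_pullback.2
          ((range_algebraMap_subring D _).1 (hx _ ⟨s, hs, rfl⟩)))
      rw [range_algebraMap_subring]
      rwa [FaithfulSMul.algebraMap_injective T L hzx] at hz⟩)
  have h2 := isMaximalTIdeal_and_isTPotentIdeal_of_vMem (T ⧸ M) L
    (P := J) (P' := J.comap (residue M D)) (fun h h' => ⟨ht.2 h, htop.2 h'⟩) F hF
    (fun b hb => ⟨residue M D b, hb, fun S _ hv => by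
      rw [vMem_insert_one] at hv ⊢
      intro x hxb hx
      obtain ⟨z, rfl, hz⟩ := hFL S x hx
      exact mem_range_pullback.2 ⟨z, (range_algebraMap_subring D _).1 (hv _
        ((range_algebraMap_subring D _).2 (algebraMap_mul_mem_range_pullback.1 hxb))
        fun s hs => (range_algebraMap_subring D _).2 (hz s hs)), rfl⟩⟩)
  exact ⟨ht, ⟨h1.1, h2.1⟩, ⟨h1.2, h2.2⟩⟩

/-- If `D` is a proper subring of `T / M`, then `M ≠ 0` is a `t`-ideal of the pullback. -/
theorem isTIdeal_contraction_self (L : Type*) [Field L] [Algebra T L] [FaithfulSMul T L]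
    (hD : D ≠ ⊤) (hM : M ≠ ⊥) : IsTIdeal (contraction D M) := by
  obtain ⟨m, hm, hm0⟩ := Submodule.exists_mem_ne_zero_of_ne_bot hM
  refine (isTIdeal_iff L).2 ⟨fun hbot => ?_, fun S _ hSM _ y hy => ?_⟩
  · exact hm0 (congrArg Subtype.val ((Submodule.eq_bot_iff _).1 hbot
      ⟨m, mem_pullback_of_mem hm⟩ hm))
  · by_contra hyM
    obtain ⟨t, n, hn, h⟩ := exists_mul_add_eq_one (M := M) (a := (y : T)) hyM
    refine hD ((Subring.eq_top_iff' D).2 fun x => ?_)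
    obtain ⟨x, rfl⟩ := Ideal.Quotient.mk_surjective x
    -- Every element of $T$ multiplies `S` into $M\subseteq R$, so it also multiplies `y` into $R$;
    -- as `y` is a unit modulo $M$, all of $T/M$ would lie in $D$.
    have key : Ideal.Quotient.mk M (t * x) * (residue M D y : T ⧸ M) ∈ D :=
      (algebraMap_mul_mem_range_pullback (L := L)).1 (hy _ fun s hs =>
        mul_mem_range_pullback ⟨_, rfl⟩ (hSM hs))
    rw [coe_residue, ← map_mul] at key
    convert key using 1
    rw [Ideal.Quotient.eq]
    have : x - t * x * y = n * x := by rw [eq_sub_of_add_eq' h]; ring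
    rw [this]
    exact M.mul_mem_right x hn

theorem isMaximalTIdeal_of_isMaximal {R : Type*} [CommRing R] [IsDomain R] {P : Ideal R}
    (hP : P.IsMaximal) (ht : IsTIdeal P) : IsMaximalTIdeal P :=
  ⟨⟨ht, hP.ne_top⟩, fun _ hQ hPQ => (hP.eq_of_le hQ.2 hPQ).ge⟩

/-- When `D` is a field, covers of `M` in `T` are covers of `M` in the pullback. -/
theorem isTPotentIdeal_contraction_self_of_vMem (L : Type*) [Field L] [Algebra T L]
    [FaithfulSMul T L] (hD : IsField D) (ht : IsTIdeal (contraction D M))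
    {S : Set T} (hS : S.Finite) (hSM : S ⊆ M) (hv : ∀ b ∉ M, VMem L (insert b S) 1) :
    IsTPotentIdeal (contraction D M) := by
  refine (isTPotentIdeal_iff L).2 ⟨⟨ht, (isMaximal_contraction_self hD).ne_top⟩,
    Subtype.val ⁻¹' S, hS.preimage Subtype.val_injective.injOn, fun s hs => hSM hs,
    fun b hb => ?_⟩
  have hvb := hv b hb
  rw [vMem_insert_one] at hvb ⊢
  intro x hxb hx
  obtain ⟨y, rfl⟩ := hvb x (range_pullback_le hxb) fun s hs =>
    range_pullback_le (hx ⟨s, mem_pullback_of_mem (hSM hs)⟩ hs)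
  have hyb := algebraMap_mul_mem_range_pullback.1 hxb
  refine mem_range_pullback.2 ⟨y, ?_, rfl⟩
  -- The residue of `b` is invertible in $D$, so $\bar y\,\bar b\in D$ yields $\bar y\in D$.
  obtain ⟨c, hc⟩ := hD.mul_inv_cancel (fun h => hb (residue_eq_zero_iff.1 h))
  have hc' : (residue M D b : T ⧸ M) * c = 1 := congrArg Subtype.val hc
  have := mul_mem hyb c.2
  rwa [mul_assoc, hc', mul_one] at this

/-- If $M$ is not a `t`-ideal of $T$, some finite $S\subseteq M$ has $y\in S^v\setminus M$. With
$yt+m=1$ and $m\in M$, already $1\in(S,m)^v$ in $T$, a cover that needs no `b`. -/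
theorem isTPotentIdeal_contraction_self (L : Type*) [Field L] [Algebra T L] [FaithfulSMul T L]
    (hD : IsField D) (ht : IsTIdeal (contraction D M)) (hM : IsTIdeal M → IsTPotentIdeal M) :
    IsTPotentIdeal (contraction D M) := by
  by_cases hMt : IsTIdeal M
  · obtain ⟨-, S, hS, hSM, hv⟩ := (isTPotentIdeal_iff L).1 (hM hMt)
    exact isTPotentIdeal_contraction_self_of_vMem L hD ht hS hSM hv
  · have hM0 : M ≠ ⊥ := by
      rintro rfl
      exact ht.1 ((Submodule.eq_bot_iff _).2 fun x hx => Subtype.ext hx)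
    have : ∃ S : Set T, S.Finite ∧ S ⊆ M ∧ ∃ y, VMem L S y ∧ y ∉ M := by
      by_contra! hcon
      exact hMt ((isTIdeal_iff L).2 ⟨hM0, fun S hS hSM _ y hy => hcon S hS hSM y hy⟩)
    obtain ⟨S, hS, hSM, y, hy, hyM⟩ := this
    obtain ⟨t, m, hm, h⟩ := exists_mul_add_eq_one hyM
    refine isTPotentIdeal_contraction_self_of_vMem L hD ht (hS.insert m)
      (Set.insert_subset hm hSM) fun b _ => ?_
    rw [← h, mul_comm]
    exact ((hy.mono ((Set.subset_insert _ _).trans (Set.subset_insert _ _))).mul_left t).add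
      (.of_mem (.inr (.inl rfl)))

theorem isTPotentIdeal_of_contraction_self (L : Type*) [Field L] [Algebra T L]
    [FaithfulSMul T L] (hM : IsTIdeal M) (h : IsTPotentIdeal (contraction D M)) :
    IsTPotentIdeal M := by
  refine (isMaximalTIdeal_and_isTPotentIdeal_of_vMem L L
    (fun _ _ => ⟨hM, Ideal.IsMaximal.ne_top ‹_›⟩) (fun S => (↑) '' S)
    (fun S hS hSM => ⟨hS.image _, by rintro _ ⟨s, hs, rfl⟩; exact hSM hs⟩) fun c hc => ?_).2 h
  obtain ⟨t, m, hm, h1⟩ := exists_mul_add_eq_one hc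
  have hct : c * t ∈ pullback M D := by
    rw [eq_sub_of_add_eq h1]
    exact sub_mem (one_mem _) (mem_pullback_of_mem hm)
  refine ⟨⟨c * t, hct⟩, fun hctM => ?_, fun S _ hv => ?_⟩
  · exact Ideal.IsMaximal.ne_top (I := M) ‹_›
      ((Ideal.eq_top_iff_one _).2 (h1 ▸ M.add_mem hctM hm))
  · exact vMem_image_of_vMem_pullback h1 hm (.inl rfl)
      (fun n hn => ⟨n * t, M.mul_mem_right t hn, by ring⟩) hv

/-- If `M` is a maximal `t`-ideal of the pullback, then `D` is a field. -/
theorem isField_of_isMaximalTIdeal_contraction_self (L : Type*) [Field L] [Algebra T L]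
    [FaithfulSMul T L] (h : IsMaximalTIdeal (contraction D M)) : IsField D := by
  by_contra hD
  obtain ⟨d, hd0, hd⟩ := Ring.exists_not_isUnit_of_not_isField hD
  -- For a nonzero nonunit `d`, the preimage of $dD$ is a proper `t`-ideal of $R$ strictly above
  -- $M$.
  have hspan : Ideal.span {d} ≠ ⊥ := by simpa using hd0
  have ht := (comap_residue_iff L hspan).1.2 (isTIdeal_span_singleton hd0)
  obtain ⟨a, rfl⟩ := residue_surjective d
  refine hd0 (residue_eq_zero_iff.2 (h.le_of_ge ⟨ht, ?_⟩ (fun x hx => ?_)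
    (Ideal.mem_span_singleton_self (residue M D a))))
  · exact fun htop => hd (Ideal.span_singleton_eq_top.1 (Ideal.comap_eq_top_iff.1 htop))
  · rw [Ideal.mem_comap, residue_eq_zero_iff.2 hx]
    exact zero_mem _

end Residue

end TOp

theorem theorem4p2 {T : Type*} [CommRing T] [IsDomain T] (M : Ideal T) [M.IsMaximal]
    (D : Subring (T ⧸ M)) (hD : D ≠ ⊤) :
    TOp.IsTPotentDomain (TOp.pullback M D) ↔
      ((TOp.IsTPotentDomain D ∨ IsField D) ∧
        (∀ N : Ideal T, TOp.IsMaximalTIdeal N → ¬ N ≤ M → TOp.IsTPotentIdeal N) ∧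
        (IsField D → TOp.IsTIdeal M → TOp.IsTPotentIdeal M)) := by
  have hMle : ∀ N : Ideal T, N.IsPrime → ¬ N ≤ M → ¬ M ≤ N := fun N hN hNM hMN =>
    hNM (Ideal.IsMaximal.eq_of_le ‹_› hN.ne_top hMN).ge
  constructor
  -- The first alternative always holds: a field is vacuously `t`-potent, having no nonzero proper
  -- ideals.
  · refine fun h => ⟨.inl fun J hJ => ?_, fun N hN hNM => ?_, fun hDf hM => ?_⟩
    · have hJ' := TOp.comap_residue_iff (FractionRing T) hJ.prop.1.1
      exact hJ'.2.2.1 (h _ (hJ'.2.1.2 hJ))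
    · have := hN.isPrime
      have hMN := hMle N this hNM
      exact (TOp.isMaximalTIdeal_and_isTPotentIdeal_of_contraction (FractionRing T) hMN hNM).2
        (h _ ((TOp.isMaximalTIdeal_and_isTPotentIdeal_contraction
          (FractionRing T) hMN hNM).1 hN))
    · exact TOp.isTPotentIdeal_of_contraction_self (FractionRing T) hM
        (h _ (TOp.isMaximalTIdeal_of_isMaximal (TOp.isMaximal_contraction_self hDf)
          (TOp.isTIdeal_contraction_self (FractionRing T) hD hM.1)))
  · rintro ⟨h1, h2, h3⟩ P hP
    by_cases hMP : TOp.contraction D M ≤ P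
    · obtain rfl | hlt := hMP.eq_or_lt
      · have hDf := TOp.isField_of_isMaximalTIdeal_contraction_self (FractionRing T) hP
        exact TOp.isTPotentIdeal_contraction_self (FractionRing T) hDf hP.prop.1 (h3 hDf)
      · obtain ⟨J, hJ, rfl⟩ := TOp.exists_comap_residue_eq hlt
        have hJ' := TOp.comap_residue_iff (FractionRing T) hJ
        have hJmax := hJ'.2.1.1 hP
        obtain hDt | hDf := h1
        · exact hJ'.2.2.2 (hDt J hJmax)
        · let := hDf.toField
          exact absurd ((Ideal.eq_bot_or_top J).resolve_left hJ) hJmax.prop.2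
    · have := hP.isPrime
      obtain ⟨Q, hQ, hMQ, rfl⟩ := TOp.exists_contraction_eq hMP
      have hM0 : M ≠ ⊥ := by
        rintro rfl
        exact hMQ bot_le
      -- Otherwise the maximal `t`-ideal $Q\cap R$ would lie in the proper `t`-ideal $M$ of $R$,
      -- hence equal it.
      have hQM : ¬ Q ≤ M := fun hle => hMP (hP.le_of_ge
        ⟨TOp.isTIdeal_contraction_self (FractionRing T) hD hM0,
          Ideal.IsPrime.ne_top (Ideal.comap_isPrime _ _)⟩ (Ideal.comap_mono hle))
      exact (TOp.isMaximalTIdeal_and_isTPotentIdeal_contraction (FractionRing T) hMQ hQM).2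
        (h2 Q ((TOp.isMaximalTIdeal_and_isTPotentIdeal_of_contraction
          (FractionRing T) hMQ hQM).1 hP) hQM)
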